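/- Let $q$ be an odd prime power, let $SO_2(\mathbb{F}_q)=\{A\in \mathbb{F}_q^{2\times 2}: AA^{T}=1,\ \det A=1\}$, and let $G_0=\mathbb{F}_q^2\rtimes SO_2(\mathbb{F}_q)$ be the group of rigid motions, with group law $(z_1,h_1)(z_2,h_2)=(z_1+h_1z_2,\,h_1h_2)$. An irreducible complex representation of $G_0$ is of type I if it is lifted from a representation of $SO_2(\mathbb{F}_q)$ through the projection $(z,h)\mapsto h$. Type I irreducible representations have degree $1$ and are taken up to isomorphism. For $X\subseteq G_0$ and such a $\rho$, put $\widehat{1_X}(\rho)=\frac{1}{|G_0|}\sum_{x\in X}\rho(x)$. There is an absolute constant $c>0$ such that the following holds for all odd prime powers $q$, all $X\subseteq G_0$, all real $M$ and all integers $k\ge 1$. If $|\widehat{1_X}(\rho)|\le M$ for all but at most $k$ of the type I irreducible representations $\rho$ of $G_0$, then, for $M\neq 0$, $$|XX|\ \ge\ c\,\min\left\{\frac{q^3}{k},\ \frac{|X|^4}{q^{10}M^4},\ \frac{|X|^2}{q^2}\right\},$$ and, for $M=0$, $$|XX|\ \ge\ c\,\min\left\{\frac{q^3}{k},\ \frac{|X|^2}{q^2}\right\}.$$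 The bound is sharp for subgroups: there is an absolute constant $C>0$ such that for all odd prime powers $q$ and every factorization $|SO_2(\mathbb{F}_q)|=kl$ into positive integers there is a subgroup $\mathcal{X}\le G_0$ of order $lq^2$ with $\widehat{1_{\mathcal{X}}}(\rho)=0$ for all but at most $k$ of the type I irreducible representations $\rho$ of $G_0$, and $$|\mathcal{X}\mathcal{X}|\ \le\ C\,\min\left\{\frac{q^3}{k},\ \frac{|\mathcal{X}|^2}{q^2}\right\}.$$ -/

import Mathlib

open scoped Pointwise

noncomputable section

namespace RigidMotion

/-- The special orthogonal group `SO₂(F)`: the `2 × 2` matrices `A` over `F` with `A Aᵀ = 1` and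
`det A = 1`. -/
abbrev SO2 (F : Type*) [Field F] : Type _ := Matrix.specialOrthogonalGroup (Fin 2) F

/-- The action of `SO₂(F)` on the additive group `F²` by matrix-vector multiplication
(`Multiplicative (Fin 2 → F)` is the additive group `F²` in multiplicative notation). -/
def rot (F : Type*) [Field F] : SO2 F →* MulAut (Multiplicative (Fin 2 → F)) where
  toFun h :=
    { toFun := fun z => Multiplicative.ofAdd ((h : Matrix (Fin 2) (Fin 2) F).mulVec z.toAdd)
      invFun := fun z => Multiplicative.ofAdd
        (((h⁻¹ : SO2 F) : Matrix (Fin 2) (Fin 2) F).mulVec z.toAdd)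
      left_inv := fun z => by
        have e : ((h⁻¹ : SO2 F) : Matrix (Fin 2) (Fin 2) F) * (h : Matrix (Fin 2) (Fin 2) F) = 1 :=
          congrArg Subtype.val (inv_mul_cancel h)
        beta_reduce
        rw [toAdd_ofAdd, Matrix.mulVec_mulVec, e, Matrix.one_mulVec, ofAdd_toAdd]
      right_inv := fun z => by
        have e : (h : Matrix (Fin 2) (Fin 2) F) * ((h⁻¹ : SO2 F) : Matrix (Fin 2) (Fin 2) F) = 1 :=
          congrArg Subtype.val (mul_inv_cancel h)
        beta_reduce
        rw [toAdd_ofAdd, Matrix.mulVec_mulVec, e, Matrix.one_mulVec, ofAdd_toAdd]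
      map_mul' := fun z w => by rw [toAdd_mul, Matrix.mulVec_add, ofAdd_add] }
  map_one' := by
    ext1 z
    exact congrArg Multiplicative.ofAdd (Matrix.one_mulVec z.toAdd)
  map_mul' g h := by
    ext1 z
    exact congrArg Multiplicative.ofAdd
      (Matrix.mulVec_mulVec z.toAdd (g : Matrix (Fin 2) (Fin 2) F) (h : Matrix (Fin 2) (Fin 2) F)).symm

/-- The group `G₀ = F² ⋊ SO₂(F)` of rigid motions of the plane `F²`, with group law
`(z₁, h₁)(z₂, h₂) = (z₁ + h₁ z₂, h₁ h₂)`. -/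
abbrev G0 (F : Type*) [Field F] : Type _ := Multiplicative (Fin 2 → F) ⋊[rot F] SO2 F

instance instFintypeSO2 (F : Type*) [Field F] [Fintype F] : Fintype (SO2 F) := by
  classical exact Fintype.ofFinite _

instance instFintypeG0 (F : Type*) [Field F] [Fintype F] : Fintype (G0 F) :=
  Fintype.ofEquiv (Multiplicative (Fin 2 → F) × SO2 F) SemidirectProduct.equivProd.symm

/-- The Fourier coefficient `f̂(ρ) = 𝔼_{x ∈ G} f(x) ρ(x)` of `f : G → ℂ` at a representation `ρ`
of a finite group `G`. -/
def fourierCoeff {G V : Type*} [Group G] [Fintype G] [AddCommGroup V] [Module ℂ V]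
    (f : G → ℂ) (ρ : Representation ℂ G V) : V →ₗ[ℂ] V :=
  (Fintype.card G : ℂ)⁻¹ • ∑ x : G, f x • ρ x

/-- The Hilbert-Schmidt norm `√Tr(a* a)` of an operator on a finite-dimensional Hilbert space.
In dimension one, `a` is a scalar and this is its absolute value. -/
def hsNorm {V : Type*} [NormedAddCommGroup V] [InnerProductSpace ℂ V] [FiniteDimensional ℂ V]
    (a : V →ₗ[ℂ] V) : ℝ :=
  √(LinearMap.trace ℂ V (LinearMap.adjoint a ∘ₗ a)).re

/-- An irreducible complex representation of `G₀` of type I: one that is lifted from a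
representation of `SO₂(F)` through the projection `(z, h) ↦ h`. It is realised by unitary operators
on some `ℂᵈ`. -/
structure TypeIIrrep (F : Type*) [Field F] where
  /-- the degree -/
  degree : ℕ
  /-- the underlying representation -/
  rep : Representation ℂ (G0 F) (EuclideanSpace ℂ (Fin degree))
  irreducible : rep.IsIrreducible
  unitary : ∀ g v, ‖rep g v‖ = ‖v‖
  lifted : ∃ σ : Representation ℂ (SO2 F) (EuclideanSpace ℂ (Fin degree)),
    ∀ g : G0 F, rep g = σ g.right

/-- `|1̂_X(ρ)| ≤ M` for all but at most `k` of the irreducible representations `ρ` of `G₀` of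
type I, counted up to isomorphism. -/
def SmallBiasOutside {F : Type*} [Field F] [Fintype F] (X : Set (G0 F)) (M : ℝ) (k : ℕ) : Prop :=
  ∃ S : Finset (TypeIIrrep F), S.card ≤ k ∧
    ∀ ρ : TypeIIrrep F, (∀ σ ∈ S, ¬ Nonempty (ρ.rep.Equiv σ.rep)) →
      hsNorm (fourierCoeff (X.indicator 1) ρ.rep) ≤ M

end RigidMotion

end

/-! Write `q = |F|`, `H = |SO₂(F)|`, `n = |X|`, `m = |XX|`. Cauchy–Schwarz on the support of `1_X *
1_X` gives `n⁴ ≤ m E`, where `E` is the squared ℓ² norm of this convolution, so it suffices to bound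
`E` from above. Take the Fourier transform in the translation variable only.

The trivial character sees just the pushforward of `1_X` to the abelian group `SO₂(F)`. Its
contribution is a fourth moment of character sums, which are the type I coefficients up to
normalisation: at most `k` of them are bounded trivially by `n`, the others by `|G₀| M`
(`sum_norm_pow_four_le`).

For a nontrivial character `ψ`, convolution mixes the values at the rotated characters `ψ ∘ k`.
Since `2 ≠ 0`, these are distinct for distinct `k`, so Cauchy–Schwarz and Parseval bound the total
of all such contributions by `q⁴ n²` (`sum_norm_sq_conv_le`). Hence `q² H n⁴ ≤ m (k n⁴ + H (q² H M)⁴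
+ q⁴ H n²)`, and since `H` is comparable to `q`, one of the three terms yields the bound.

For sharpness, `SO₂(F)` is cyclic. The preimage of its subgroup of order `l` is a subgroup of `G₀`
whose type I coefficients vanish except at the characters trivial on that subgroup, of which there
are at most `k`. -/

namespace RigidMotion

/-! ### The group of plane rotations: freeness, size, cyclicity. -/

section SpecialOrthogonal

variable {F : Type*} [Field F]

theorem SO2.entries (h : SO2 F) : h.1 0 0 = h.1 1 1 ∧ h.1 0 1 = -h.1 1 0 ∧
    h.1 0 0 ^ 2 + h.1 0 1 ^ 2 = 1 :=
  Matrix.mem_specialOrthogonalGroup_fin_two_iff.1 h.2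

theorem SO2.ext_of_entries {g h : SO2 F} (h0 : g.1 0 0 = h.1 0 0) (h1 : g.1 0 1 = h.1 0 1) :
    g = h := by
  obtain ⟨a, b, -⟩ := g.entries
  obtain ⟨c, d, -⟩ := h.entries
  have h2 : g.1 1 0 = h.1 1 0 := by
    rw [← neg_inj, ← b, ← d, h1]
  ext i j
  fin_cases i <;> fin_cases j
  · exact h0
  · exact h1
  · exact h2
  · exact a ▸ c ▸ h0

theorem SO2.mul_zero_zero (g h : SO2 F) :
    (g * h).1 0 0 = g.1 0 0 * h.1 0 0 - g.1 0 1 * h.1 0 1 := by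
  obtain ⟨c, d, -⟩ := h.entries
  change (g.1 * h.1) 0 0 = _
  rw [Matrix.mul_apply, Fin.sum_univ_two, d]
  ring

theorem SO2.mul_zero_one (g h : SO2 F) :
    (g * h).1 0 1 = g.1 0 0 * h.1 0 1 + g.1 0 1 * h.1 0 0 := by
  obtain ⟨c, d, -⟩ := h.entries
  change (g.1 * h.1) 0 1 = _
  rw [Matrix.mul_apply, Fin.sum_univ_two, c]

/-- Rotations of the plane commute. -/
instance instCommGroupSO2 : CommGroup (SO2 F) :=
  { (inferInstance : Group (SO2 F)) with
    mul_comm := fun g h => SO2.ext_of_entries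
      (by rw [SO2.mul_zero_zero, SO2.mul_zero_zero]; ring)
      (by rw [SO2.mul_zero_one, SO2.mul_zero_one]; ring) }

theorem SO2.one_entries : (1 : SO2 F).1 0 0 = 1 ∧ (1 : SO2 F).1 0 1 = 0 :=
  ⟨Matrix.one_apply_eq 0, Matrix.one_apply_ne (by decide)⟩

/-- If the first row is `(a, b)`, then `a² + b² = 1` turns the determinant `(a - 1)² + b²` into `2
(1 - a)`; its vanishing forces `a = 1` and then `b = 0`. -/
theorem SO2.det_sub_one_ne_zero (h2 : (2 : F) ≠ 0) {g : SO2 F} (hg : g ≠ 1) :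
    (g.1 - 1).det ≠ 0 := by
  obtain ⟨a, b, c⟩ := g.entries
  intro h
  rw [Matrix.det_fin_two] at h
  simp only [Matrix.sub_apply, Matrix.one_apply, Fin.isValue, if_true, zero_ne_one, one_ne_zero,
    if_false, sub_zero, ← a] at h
  have e : 2 * (1 - g.1 0 0) = 0 := by
    have : g.1 1 0 = -g.1 0 1 := by rw [b, neg_neg]
    rw [this] at h
    linear_combination h - c
  have e0 : g.1 0 0 = 1 := (sub_eq_zero.1 ((mul_eq_zero.1 e).resolve_left h2)).symm
  have e1 : g.1 0 1 = 0 := by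
    rw [e0] at c
    exact pow_eq_zero_iff two_ne_zero |>.1 (by linear_combination c)
  exact hg (SO2.ext_of_entries (e0.trans SO2.one_entries.1.symm) (e1.trans SO2.one_entries.2.symm))

/-- A nontrivial rotation moves every nontrivial additive character of the plane. -/
theorem SO2.comp_mulVec_ne (h2 : (2 : F) ≠ 0) {g : SO2 F} (hg : g ≠ 1)
    {ψ : AddChar (Fin 2 → F) ℂ} (hψ : ψ ≠ 1) : ∃ z, ψ (g.1.mulVec z) ≠ ψ z := by
  by_contra! h
  refine hψ (DFunLike.ext _ _ fun w => ?_)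
  -- Every vector has the form `g z - z`, and an invariant `ψ` equals `1` on such vectors.
  have hu : IsUnit (g.1 - 1).det := (SO2.det_sub_one_ne_zero h2 hg).isUnit
  obtain ⟨z, rfl⟩ : ∃ z, (g.1 - 1).mulVec z = w :=
    ⟨(g.1 - 1)⁻¹.mulVec w, by rw [Matrix.mulVec_mulVec, Matrix.mul_nonsing_inv _ hu,
      Matrix.one_mulVec]⟩
  rw [Matrix.sub_mulVec, Matrix.one_mulVec, AddChar.map_sub_eq_div, h, AddChar.one_apply,
    div_self]
  exact (ψ.val_isUnit z).ne_zero

/-- The contragredient action of a rotation on additive characters. -/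
noncomputable def rotChar (h : SO2 F) (ψ : AddChar (Fin 2 → F) ℂ) : AddChar (Fin 2 → F) ℂ :=
  ψ.compAddMonoidHom (Matrix.mulVecLin h.1).toAddMonoidHom

@[simp]
theorem rotChar_apply (h : SO2 F) (ψ : AddChar (Fin 2 → F) ℂ) (z : Fin 2 → F) :
    rotChar h ψ z = ψ (h.1.mulVec z) := rfl

theorem rotChar_one_right (h : SO2 F) : rotChar h 1 = 1 := rfl

theorem rotChar_injective (h2 : (2 : F) ≠ 0) {ψ : AddChar (Fin 2 → F) ℂ} (hψ : ψ ≠ 1) :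
    Function.Injective fun h : SO2 F => rotChar h ψ := by
  intro g h e
  by_contra hne
  have hgh : g * h⁻¹ ≠ 1 := fun e => hne (mul_inv_eq_one.1 e)
  obtain ⟨z, hz⟩ := SO2.comp_mulVec_ne h2 hgh hψ
  apply hz
  have := DFunLike.congr_fun e ((h⁻¹).1.mulVec z)
  simp only [rotChar_apply, Matrix.mulVec_mulVec] at this
  have e1 : h.1 * (h⁻¹).1 = 1 := congrArg Subtype.val (mul_inv_cancel h)
  rw [e1, Matrix.one_mulVec] at this
  exact this

theorem two_ne_zero_of_odd_card [Fintype F] (hF : Odd (Fintype.card F)) : (2 : F) ≠ 0 := by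
  apply Ring.two_ne_zero
  intro h
  exact Nat.not_even_iff_odd.2 hF (FiniteField.even_card_iff_char_two.1 h |> Nat.even_iff.2)

/-- The rotation with first row `(a, b)`. -/
def SO2.mk (a b : F) (h : a ^ 2 + b ^ 2 = 1) : SO2 F :=
  ⟨!![a, b; -b, a], Matrix.of_mem_specialOrthogonalGroup_fin_two_iff.2 ⟨rfl, by simp, h⟩⟩

/-- Given the first entry `a`, the second solves `b² = 1 - a²`, which has at most two roots. -/
theorem SO2.card_le [Fintype F] : Fintype.card (SO2 F) ≤ 2 * Fintype.card F := by
  classical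
  have := Finset.card_le_mul_card_image_of_maps_to (s := (Finset.univ : Finset (SO2 F)))
    (t := (Finset.univ : Finset F)) (f := fun h => h.1 0 0) (fun _ _ => Finset.mem_univ _) 2 ?_
  · simpa using this
  intro a _
  by_contra! hc
  obtain ⟨x, hx, y, hy, z, hz, hxy, hxz, hyz⟩ := Finset.two_lt_card.1 hc
  simp only [Finset.mem_filter, Finset.mem_univ, true_and] at hx hy hz
  have key : ∀ {u v : SO2 F}, u.1 0 0 = a → v.1 0 0 = a → u ≠ v → u.1 0 1 = -v.1 0 1 := by
    intro u v hu hv huv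
    have h1 := u.entries.2.2
    have h2 := v.entries.2.2
    rw [hu] at h1
    rw [hv] at h2
    have : u.1 0 1 ^ 2 = v.1 0 1 ^ 2 := by linear_combination h1 - h2
    rcases sq_eq_sq_iff_eq_or_eq_neg.1 this with h | h
    · exact (huv (SO2.ext_of_entries (hu.trans hv.symm) h)).elim
    · exact h
  refine hyz (SO2.ext_of_entries (hy.trans hz.symm) ?_)
  rw [← neg_inj, ← key hx hy hxy, ← key hx hz hxz]

/-- The rational parametrisation of the circle is injective where `1 + t² ≠ 0`, which excludes at
most two values of `t`. -/
theorem SO2.le_card [Fintype F] (h2 : (2 : F) ≠ 0) :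
    Fintype.card F ≤ Fintype.card (SO2 F) + 2 := by
  classical
  let S : Finset F := Finset.univ.filter fun t => 1 + t ^ 2 ≠ 0
  have hS : S.card ≤ Fintype.card (SO2 F) := by
    rw [← Finset.card_univ]
    refine Finset.card_le_card_of_injOn
      (fun t => if ht : 1 + t ^ 2 ≠ 0 then
        SO2.mk ((1 - t ^ 2) / (1 + t ^ 2)) (2 * t / (1 + t ^ 2)) (by field_simp; ring) else 1)
      (fun _ _ => Finset.mem_coe.2 (Finset.mem_univ _)) ?_
    intro s hs t ht hst
    have hs' : 1 + s ^ 2 ≠ 0 := (Finset.mem_filter.1 hs).2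
    have ht' : 1 + t ^ 2 ≠ 0 := (Finset.mem_filter.1 ht).2
    simp only [hs', ht', ne_eq, not_false_eq_true, dif_pos] at hst
    have e0 : (1 - s ^ 2) / (1 + s ^ 2) = (1 - t ^ 2) / (1 + t ^ 2) :=
      congrFun (congrFun (congrArg Subtype.val hst) 0) 0
    have e1 : 2 * s / (1 + s ^ 2) = 2 * t / (1 + t ^ 2) :=
      congrFun (congrFun (congrArg Subtype.val hst) 0) 1
    rw [div_eq_div_iff hs' ht'] at e0 e1
    have e2 : s ^ 2 = t ^ 2 := by
      have : 2 * (s ^ 2 - t ^ 2) = 0 := by linear_combination -e0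
      exact sub_eq_zero.1 ((mul_eq_zero.1 this).resolve_left h2)
    rw [e2] at e1
    exact mul_left_cancel₀ h2 (mul_right_cancel₀ ht' e1)
  have hc : (Finset.univ.filter fun t : F => ¬ (1 + t ^ 2 ≠ 0)).card ≤ 2 := by
    by_contra! hc
    obtain ⟨x, hx, y, hy, z, hz, hxy, hxz, hyz⟩ := Finset.two_lt_card.1 hc
    simp only [Finset.mem_filter, Finset.mem_univ, true_and] at hx hy hz
    have key : ∀ {u v : F}, 1 + u ^ 2 = 0 → 1 + v ^ 2 = 0 → u ≠ v → u = -v := by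
      intro u v hu hv huv
      exact (sq_eq_sq_iff_eq_or_eq_neg.1 (by linear_combination hu - hv)).resolve_left huv
    exact hyz (by rw [← neg_inj, ← key hx hy hxy, ← key hx hz hxz])
  have := Finset.card_filter_add_card_filter_not (s := (Finset.univ : Finset F))
    (fun t => 1 + t ^ 2 ≠ 0)
  rw [Finset.card_univ] at this
  change S.card + _ = _ at this
  omega

/-- With `i² = -1` in the algebraic closure, `(a, b) ↦ a + b i` embeds the rotations
multiplicatively in a field, where finite groups are cyclic. Injectivity: if `a + b i = 1`, then `a²
+ b² = 1` gives `a - b i = 1` too. -/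
theorem SO2.isCyclic [Finite F] (h2 : (2 : F) ≠ 0) : IsCyclic (SO2 F) := by
  obtain ⟨i, hi⟩ := IsAlgClosed.exists_pow_nat_eq (-1 : AlgebraicClosure F) two_pos
  let A := algebraMap F (AlgebraicClosure F)
  let f : SO2 F →* AlgebraicClosure F :=
    { toFun := fun h => A (h.1 0 0) + A (h.1 0 1) * i
      map_one' := by rw [SO2.one_entries.1, SO2.one_entries.2]; simp
      map_mul' := fun g h => by
        rw [SO2.mul_zero_zero, SO2.mul_zero_one, map_sub, map_add, map_mul, map_mul, map_mul,
          map_mul]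
        linear_combination -A (g.1 0 1) * A (h.1 0 1) * hi }
  refine isCyclic_of_injective_ringHom f ((injective_iff_map_eq_one f).2 fun h hh => ?_)
  have h1 : A (h.1 0 0) + A (h.1 0 1) * i = 1 := hh
  have h3 : A (h.1 0 0) ^ 2 + A (h.1 0 1) ^ 2 = 1 := by
    rw [← map_pow, ← map_pow, ← map_add, h.entries.2.2, map_one]
  have h4 : A (h.1 0 0) - A (h.1 0 1) * i = 1 := by
    linear_combination h3 - A (h.1 0 1) ^ 2 * hi - (A (h.1 0 0) - A (h.1 0 1) * i) * h1
  have e0 : h.1 0 0 = 1 := by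
    apply A.injective
    have h2' : A 2 ≠ 0 := (map_ne_zero A).2 h2
    apply mul_left_cancel₀ h2'
    rw [map_one, map_ofNat]
    linear_combination h1 + h4
  have e1 : h.1 0 1 = 0 := by
    have := h.entries.2.2
    rw [e0] at this
    exact pow_eq_zero_iff two_ne_zero |>.1 (by linear_combination this)
  exact SO2.ext_of_entries (e0.trans SO2.one_entries.1.symm) (e1.trans SO2.one_entries.2.symm)

theorem card_G0 [Fintype F] :
    Fintype.card (G0 F) = Fintype.card F ^ 2 * Fintype.card (SO2 F) := by
  rw [Fintype.card_congr SemidirectProduct.equivProd, Fintype.card_prod,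
    Fintype.card_multiplicative, Fintype.card_fun, Fintype.card_fin]

end SpecialOrthogonal

/-! ### Parseval and convolution on finite groups. -/

/-- Parseval's identity on a finite abelian group. -/
theorem sum_norm_sq_fourier {A : Type*} [AddCommGroup A] [Fintype A] (g : A → ℂ) :
    ∑ ψ : AddChar A ℂ, ‖∑ a, g a * ψ a‖ ^ 2 = Fintype.card A * ∑ a, ‖g a‖ ^ 2 := by
  classical
  apply Complex.ofReal_injective
  push_cast
  have key : ∀ ψ : AddChar A ℂ, ((‖∑ a, g a * ψ a‖ : ℂ)) ^ 2 =
      ∑ a, ∑ b, g a * (starRingEnd ℂ) (g b) * ψ (a - b) := by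
    intro ψ
    rw [← Complex.mul_conj', map_sum, Finset.sum_mul_sum]
    refine Finset.sum_congr rfl fun a _ => Finset.sum_congr rfl fun b _ => ?_
    rw [map_mul, sub_eq_add_neg, AddChar.map_add_eq_mul, AddChar.map_neg_eq_conj]
    ring
  simp_rw [key]
  rw [Finset.sum_comm, Finset.mul_sum]
  refine Finset.sum_congr rfl fun a _ => ?_
  rw [Finset.sum_comm]
  simp_rw [← Finset.mul_sum, AddChar.sum_apply_eq_ite, sub_eq_zero]
  simp only [mul_ite, mul_zero, Finset.sum_ite_eq, Finset.mem_univ,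
    if_true, Complex.mul_conj']
  ring

/-- The (unnormalised) convolution of two functions on a finite group. -/
def conv {G : Type*} [Group G] [Fintype G] (f g : G → ℂ) (x : G) : ℂ := ∑ y, f y * g (y⁻¹ * x)

theorem sum_conv_mul {G : Type*} [Group G] [Fintype G] (f g χ : G → ℂ)
    (hχ : ∀ x y, χ (x * y) = χ x * χ y) :
    ∑ x, conv f g x * χ x = (∑ x, f x * χ x) * ∑ x, g x * χ x := by
  simp_rw [conv, Finset.sum_mul]
  rw [Finset.sum_comm]
  refine Finset.sum_congr rfl fun y _ => ?_
  rw [Finset.mul_sum]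
  refine Fintype.sum_equiv (Equiv.mulLeft y⁻¹) _ _ fun x => ?_
  rw [Equiv.coe_mulLeft]
  have : χ x = χ y * χ (y⁻¹ * x) := by rw [← hχ, mul_inv_cancel_left]
  rw [this]
  ring

theorem sum_conv {G : Type*} [Group G] [Fintype G] (f g : G → ℂ) :
    ∑ x, conv f g x = (∑ x, f x) * ∑ x, g x := by
  simpa using sum_conv_mul f g (fun _ => 1) (by simp)

/-! ### Partial Fourier transform and the energy of a convolution. -/

section Plane

variable {F : Type*} [Field F]

theorem inv_mul_mk (z w : Fin 2 → F) (g h : SO2 F) :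
    (⟨Multiplicative.ofAdd z, g⟩ : G0 F)⁻¹ * ⟨Multiplicative.ofAdd (z + g.1.mulVec w), h⟩ =
      ⟨Multiplicative.ofAdd w, g⁻¹ * h⟩ := by
  rw [inv_mul_eq_iff_eq_mul]
  refine SemidirectProduct.ext ?_ ?_
  · rfl
  · exact (mul_inv_cancel_left g h).symm

variable [Fintype F]

/-- The Fourier transform of a function on the rigid motion group in the translation variable. -/
def translationFourier (f : G0 F → ℂ) (ψ : AddChar (Fin 2 → F) ℂ) (h : SO2 F) : ℂ :=
  ∑ z : Fin 2 → F, f ⟨Multiplicative.ofAdd z, h⟩ * ψ z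

theorem sum_G0 {M : Type*} [AddCommMonoid M] (f : G0 F → M) :
    ∑ x, f x = ∑ h : SO2 F, ∑ z : Fin 2 → F, f ⟨Multiplicative.ofAdd z, h⟩ := by
  have e : ∑ x, f x = ∑ p : (Fin 2 → F) × SO2 F, f ⟨Multiplicative.ofAdd p.1, p.2⟩ :=
    Fintype.sum_equiv (SemidirectProduct.equivProd.trans
      (Multiplicative.toAdd.prodCongr (Equiv.refl _))) _ _ fun _ => rfl
  rw [e, Fintype.sum_prod_type_right]

/-- The twist by `k` arises because the translation part of the second factor is rotated by `k`:
substitute `z + k w` for the translation variable. -/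
theorem translationFourier_conv (f g : G0 F → ℂ) (ψ : AddChar (Fin 2 → F) ℂ) (h : SO2 F) :
    translationFourier (conv f g) ψ h =
      ∑ k : SO2 F, translationFourier f ψ k * translationFourier g (rotChar k ψ) (k⁻¹ * h) := by
  simp_rw [translationFourier, conv, sum_G0, Finset.sum_mul]
  rw [Finset.sum_comm]
  refine Finset.sum_congr rfl fun k _ => ?_
  rw [Finset.sum_comm]
  refine Finset.sum_congr rfl fun z _ => ?_
  rw [Finset.mul_sum]
  symm
  let e : (Fin 2 → F) ≃ (Fin 2 → F) :=
    { toFun := fun w => z + k.1.mulVec w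
      invFun := fun w => (k⁻¹).1.mulVec (w - z)
      left_inv := fun w => by
        have : (k⁻¹).1 * k.1 = 1 := congrArg Subtype.val (inv_mul_cancel k)
        beta_reduce
        rw [add_sub_cancel_left, Matrix.mulVec_mulVec, this, Matrix.one_mulVec]
      right_inv := fun w => by
        have : k.1 * (k⁻¹).1 = 1 := congrArg Subtype.val (mul_inv_cancel k)
        beta_reduce
        rw [Matrix.mulVec_mulVec, this, Matrix.one_mulVec, add_sub_cancel] }
  refine Fintype.sum_equiv e _ _ fun w => ?_
  change _ = _ * g (_ * ⟨Multiplicative.ofAdd (z + k.1.mulVec w), h⟩) * ψ (z + k.1.mulVec w)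
  rw [inv_mul_mk, AddChar.map_add_eq_mul, rotChar_apply]
  ring

theorem sum_norm_sq_translationFourier (f : G0 F → ℂ) :
    ∑ ψ, ∑ h, ‖translationFourier f ψ h‖ ^ 2 = Fintype.card F ^ 2 * ∑ x, ‖f x‖ ^ 2 := by
  rw [Finset.sum_comm, sum_G0 fun x => ‖f x‖ ^ 2, Finset.mul_sum]
  refine Finset.sum_congr rfl fun h _ => ?_
  have := sum_norm_sq_fourier fun z : Fin 2 → F => f ⟨Multiplicative.ofAdd z, h⟩
  rw [Fintype.card_fun, Fintype.card_fin, Nat.cast_pow] at this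
  exact this

/-- This is the mixing estimate. After Cauchy–Schwarz over `k`, the factor from `g` runs over the
orbit of `ψ`, without repetition by `rotChar_injective`, so it is a part of the full Parseval sum of
`g`. -/
theorem sum_norm_sq_translationFourier_conv_le (h2 : (2 : F) ≠ 0) (f g : G0 F → ℂ)
    {ψ : AddChar (Fin 2 → F) ℂ} (hψ : ψ ≠ 1) :
    ∑ h, ‖translationFourier (conv f g) ψ h‖ ^ 2 ≤
      (∑ h, ‖translationFourier f ψ h‖ ^ 2) * (Fintype.card F ^ 2 * ∑ x, ‖g x‖ ^ 2) := by
  classical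
  calc ∑ h, ‖translationFourier (conv f g) ψ h‖ ^ 2
      ≤ ∑ h, (∑ k, ‖translationFourier f ψ k‖ ^ 2) *
          ∑ k, ‖translationFourier g (rotChar k ψ) (k⁻¹ * h)‖ ^ 2 := by
        refine Finset.sum_le_sum fun h _ => ?_
        rw [translationFourier_conv]
        refine le_trans (pow_le_pow_left₀ (norm_nonneg _) (norm_sum_le _ _) 2) ?_
        simp_rw [norm_mul]
        exact Finset.sum_mul_sq_le_sq_mul_sq _ _ _
    _ = (∑ k, ‖translationFourier f ψ k‖ ^ 2) *
          ∑ k, ∑ h, ‖translationFourier g (rotChar k ψ) h‖ ^ 2 := by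
        rw [← Finset.mul_sum, Finset.sum_comm]
        congr 1
        refine Finset.sum_congr rfl fun k _ => ?_
        exact Fintype.sum_equiv (Equiv.mulLeft k⁻¹) _ _ fun h => rfl
    _ ≤ _ := by
        refine mul_le_mul_of_nonneg_left ?_ (by positivity)
        rw [← sum_norm_sq_translationFourier]
        rw [← Finset.sum_image (s := Finset.univ)
          (f := fun φ => ∑ h, ‖translationFourier g φ h‖ ^ 2) (rotChar_injective h2 hψ).injOn]
        exact Finset.sum_le_sum_of_subset_of_nonneg (Finset.subset_univ _)
          fun _ _ _ => by positivity

/-- The mass of a function on the fibres of the projection to the rotation group. -/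
def fiberSum (f : G0 F → ℂ) (h : SO2 F) : ℂ := ∑ z : Fin 2 → F, f ⟨Multiplicative.ofAdd z, h⟩

theorem translationFourier_one (f : G0 F → ℂ) : translationFourier f 1 = fiberSum f := by
  funext h
  simp [translationFourier, fiberSum]

theorem fiberSum_conv (f g : G0 F → ℂ) :
    fiberSum (conv f g) = conv (fiberSum f) (fiberSum g) := by
  funext h
  rw [← translationFourier_one, translationFourier_conv]
  simp_rw [rotChar_one_right, translationFourier_one]
  rfl

/-- The energy of a convolution is controlled by its projection to the rotation group, up to an
error coming from the mixing property of the action. -/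
theorem sum_norm_sq_conv_le (h2 : (2 : F) ≠ 0) (f g : G0 F → ℂ) :
    Fintype.card F ^ 2 * ∑ x, ‖conv f g x‖ ^ 2 ≤
      ∑ h, ‖conv (fiberSum f) (fiberSum g) h‖ ^ 2 +
        (Fintype.card F ^ 2 * ∑ x, ‖f x‖ ^ 2) * (Fintype.card F ^ 2 * ∑ x, ‖g x‖ ^ 2) := by
  classical
  rw [← sum_norm_sq_translationFourier (conv f g),
    ← Finset.add_sum_erase _ _ (Finset.mem_univ (1 : AddChar (Fin 2 → F) ℂ)),
    translationFourier_one, fiberSum_conv, ← sum_norm_sq_translationFourier f, Finset.sum_mul]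
  refine add_le_add_right ?_ _
  refine (Finset.sum_le_sum fun ψ hψ => sum_norm_sq_translationFourier_conv_le h2 f g
    (Finset.ne_of_mem_erase hψ)).trans ?_
  exact Finset.sum_le_sum_of_subset_of_nonneg (Finset.subset_univ _) fun _ _ _ => by positivity

/-- Parseval for the fourth moment of the characters of the rotation group. -/
theorem sum_norm_pow_four (f : SO2 F → ℂ) :
    ∑ χ : AddChar (Additive (SO2 F)) ℂ, ‖∑ h, f h * χ (Additive.ofMul h)‖ ^ 4 =
      Fintype.card (SO2 F) * ∑ h, ‖conv f f h‖ ^ 2 := by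
  have := sum_norm_sq_fourier fun a : Additive (SO2 F) => conv f f a.toMul
  rw [Fintype.card_additive, Fintype.sum_equiv Additive.toMul _ (fun h => ‖conv f f h‖ ^ 2)
    fun _ => rfl] at this
  refine Eq.trans (Finset.sum_congr rfl fun χ _ => ?_) this
  have e := sum_conv_mul f f (fun h => χ (Additive.ofMul h))
    (fun x y => AddChar.map_add_eq_mul χ _ _)
  have e' : ∑ a : Additive (SO2 F), conv f f a.toMul * χ a =
      ∑ h, conv f f h * χ (Additive.ofMul h) :=
    Fintype.sum_equiv Additive.toMul _ _ fun _ => rfl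
  rw [e', e, norm_mul]
  ring

end Plane

/-! ### Type I coefficients as character sums, and the main inequality. -/

section TypeI

variable {F : Type*} [Field F]

/-- The one-dimensional representation of the rigid motion group lifted from a character of the
rotation group. -/
def charRep (χ : AddChar (Additive (SO2 F)) ℂ) :
    Representation ℂ (G0 F) (EuclideanSpace ℂ (Fin 1)) where
  toFun g := χ (Additive.ofMul g.right) • LinearMap.id
  map_one' := by
    rw [SemidirectProduct.one_right, ofMul_one, AddChar.map_zero_eq_one, one_smul]
    rfl
  map_mul' g h := by
    rw [SemidirectProduct.mul_right, ofMul_mul, AddChar.map_add_eq_mul]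
    ext v
    simp [mul_smul]
    ring

theorem charRep_apply (χ : AddChar (Additive (SO2 F)) ℂ) (g : G0 F) :
    charRep χ g = χ (Additive.ofMul g.right) • LinearMap.id := rfl

theorem isIrreducible_of_finrank_eq_one {G V : Type*} [Group G] [AddCommGroup V] [Module ℂ V]
    (ρ : Representation ℂ G V) (h : Module.finrank ℂ V = 1) : ρ.IsIrreducible := by
  have hs : IsSimpleOrder (Submodule ℂ V) := is_simple_module_of_finrank_eq_one h
  have : Nontrivial (Subrepresentation ρ) := by
    refine ⟨⊥, ⊤, fun e => ?_⟩
    exact bot_ne_top (α := Submodule ℂ V) (congrArg Subrepresentation.toSubmodule e)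
  refine ⟨fun a => ?_⟩
  rcases hs.eq_bot_or_eq_top a.toSubmodule with h | h
  · exact Or.inl (Subrepresentation.toSubmodule_injective h)
  · exact Or.inr (Subrepresentation.toSubmodule_injective h)

/-- The type I representation given by a character of the rotation group. -/
def charIrrep [Finite F] (χ : AddChar (Additive (SO2 F)) ℂ) : TypeIIrrep F where
  degree := 1
  rep := charRep χ
  irreducible := isIrreducible_of_finrank_eq_one _ (by simp)
  unitary g v := by
    have : Finite (Additive (SO2 F)) := inferInstanceAs (Finite (SO2 F))
    rw [charRep_apply, LinearMap.smul_apply, norm_smul, AddChar.norm_apply, one_mul,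
      LinearMap.id_apply]
  lifted :=
    ⟨(charRep χ).comp SemidirectProduct.inr, fun g => by
      rw [MonoidHom.comp_apply, charRep_apply, charRep_apply, SemidirectProduct.right_inr]⟩

/-- Ensures that each exceptional representation accounts for at most one exceptional character. -/
theorem charRep_equiv_injective {V : Type*} [AddCommGroup V] [Module ℂ V]
    {σ : Representation ℂ (G0 F) V} {χ χ' : AddChar (Additive (SO2 F)) ℂ}
    (e : (charRep χ).Equiv σ) (e' : (charRep χ').Equiv σ) : χ = χ' := by
  refine DFunLike.ext _ _ fun a => ?_
  let g : G0 F := SemidirectProduct.inr a.toMul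
  obtain ⟨v, hv⟩ := exists_ne (0 : EuclideanSpace ℂ (Fin 1))
  have hf := (e.trans e'.symm).isIntertwining' g
  have h := LinearMap.congr_fun hf v
  rw [charRep_apply, charRep_apply] at h
  simp only [LinearMap.comp_apply, LinearMap.smul_apply, LinearMap.id_apply, map_smul] at h
  exact smul_left_injective ℂ (m := (e.trans e'.symm) v)
    ((map_ne_zero_iff _ (e.trans e'.symm).injective).2 hv) h

theorem hsNorm_smul_id {d : ℕ} (c : ℂ) :
    hsNorm (c • (LinearMap.id : EuclideanSpace ℂ (Fin d) →ₗ[ℂ] _)) = √d * ‖c‖ := by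
  have h : LinearMap.adjoint (c • (LinearMap.id : EuclideanSpace ℂ (Fin d) →ₗ[ℂ] _)) ∘ₗ
      (c • LinearMap.id) = ((‖c‖ : ℂ) ^ 2) • LinearMap.id := by
    rw [map_smulₛₗ, LinearMap.adjoint_id, LinearMap.smul_comp, LinearMap.comp_smul,
      LinearMap.comp_id, smul_smul, Complex.conj_mul']
  rw [hsNorm, h, map_smul, LinearMap.trace_id, finrank_euclideanSpace_fin, smul_eq_mul,
    ← Complex.ofReal_pow, ← Complex.ofReal_natCast, ← Complex.ofReal_mul, Complex.ofReal_re,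
    mul_comm, Real.sqrt_mul (Nat.cast_nonneg d), Real.sqrt_sq (norm_nonneg c)]

variable [Fintype F]

theorem hsNorm_fourierCoeff_charRep (f : G0 F → ℂ) (χ : AddChar (Additive (SO2 F)) ℂ) :
    ‖∑ h, fiberSum f h * χ (Additive.ofMul h)‖ =
      Fintype.card (G0 F) * hsNorm (fourierCoeff f (charRep χ)) := by
  have h : fourierCoeff f (charRep χ) = ((Fintype.card (G0 F) : ℂ)⁻¹ *
      ∑ h, fiberSum f h * χ (Additive.ofMul h)) • LinearMap.id := by
    rw [fourierCoeff, mul_smul]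
    congr 1
    simp_rw [charRep_apply, smul_smul]
    rw [← Finset.sum_smul, sum_G0]
    simp_rw [fiberSum, Finset.sum_mul]
  have hG : (Fintype.card (G0 F) : ℝ) ≠ 0 := Nat.cast_ne_zero.2 Fintype.card_ne_zero
  rw [h, hsNorm_smul_id, norm_mul, norm_inv, Complex.norm_natCast]
  simp only [Nat.cast_one, Real.sqrt_one, one_mul]
  field_simp

theorem sum_norm_indicator (X : Set (G0 F)) (p : ℕ) (hp : p ≠ 0) :
    ∑ x, ‖X.indicator (1 : G0 F → ℂ) x‖ ^ p = X.ncard := by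
  classical
  rw [Set.ncard_eq_toFinset_card' X, Finset.card_eq_sum_ones, Nat.cast_sum,
    ← Finset.sum_subset (Finset.subset_univ X.toFinset)]
  · exact Finset.sum_congr rfl fun x hx => by simp [Set.mem_toFinset.1 hx]
  · intro x _ hx
    rw [Set.indicator_of_notMem (fun h => hx (Set.mem_toFinset.2 h)), norm_zero, zero_pow hp]

theorem norm_fourier_fiberSum_le (X : Set (G0 F)) (χ : AddChar (Additive (SO2 F)) ℂ) :
    ‖∑ h, fiberSum (X.indicator 1) h * χ (Additive.ofMul h)‖ ≤ X.ncard := by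
  have : Finite (Additive (SO2 F)) := inferInstanceAs (Finite (SO2 F))
  rw [← sum_norm_indicator X 1 one_ne_zero, sum_G0]
  refine (norm_sum_le _ _).trans (Finset.sum_le_sum fun h _ => ?_)
  rw [norm_mul, AddChar.norm_apply, mul_one]
  simp_rw [pow_one]
  exact norm_sum_le _ _

theorem sum_norm_pow_four_le {X : Set (G0 F)} {M : ℝ} {k : ℕ}
    (hX : SmallBiasOutside X M k) :
    ∑ χ : AddChar (Additive (SO2 F)) ℂ,
        ‖∑ h, fiberSum (X.indicator 1) h * χ (Additive.ofMul h)‖ ^ 4 ≤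
      k * (X.ncard : ℝ) ^ 4 + Fintype.card (SO2 F) * (Fintype.card (G0 F) * M) ^ 4 := by
  classical
  obtain ⟨S, hS, hM'⟩ := hX
  let B : Finset (AddChar (Additive (SO2 F)) ℂ) :=
    Finset.univ.filter fun χ => ∃ σ ∈ S, Nonempty ((charRep χ).Equiv σ.rep)
  have hB : B.card ≤ k := by
    refine le_trans (Finset.card_le_card_of_forall_subsingleton
      (fun χ σ => Nonempty ((charRep χ).Equiv σ.rep)) (fun χ hχ => ?_) fun σ _ => ?_) hS
    · exact (Finset.mem_filter.1 hχ).2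
    · rintro χ ⟨-, ⟨e⟩⟩ χ' ⟨-, ⟨e'⟩⟩
      exact charRep_equiv_injective e e'
  rw [← Finset.sum_add_sum_compl B]
  refine add_le_add ?_ ?_
  · refine (Finset.sum_le_card_nsmul B _ ((X.ncard : ℝ) ^ 4) fun χ _ =>
      pow_le_pow_left₀ (norm_nonneg _) (norm_fourier_fiberSum_le X χ) 4).trans ?_
    rw [nsmul_eq_mul]
    exact mul_le_mul_of_nonneg_right (Nat.cast_le.2 hB) (by positivity)
  · refine (Finset.sum_le_card_nsmul _ _ ((Fintype.card (G0 F) * M) ^ 4) fun χ hχ => ?_).trans ?_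
    · rw [hsNorm_fourierCoeff_charRep]
      have h0 : 0 ≤ hsNorm (fourierCoeff (X.indicator 1) (charRep χ)) := Real.sqrt_nonneg _
      refine pow_le_pow_left₀ (by positivity) (mul_le_mul_of_nonneg_left ?_ (by positivity)) 4
      refine hM' (charIrrep χ) fun σ hσ he => ?_
      exact (Finset.mem_compl.1 hχ) (Finset.mem_filter.2 ⟨Finset.mem_univ _, σ, hσ, he⟩)
    · rw [nsmul_eq_mul]
      refine mul_le_mul_of_nonneg_right (Nat.cast_le.2 ?_) (by positivity)
      refine (Finset.card_le_univ _).trans ?_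
      rw [AddChar.card_eq, Fintype.card_additive]

/-- Cauchy–Schwarz: the convolution has total mass `|X|²` and is supported on `X * X`. -/
theorem ncard_pow_four_le_mul_sum (X : Set (G0 F)) :
    (X.ncard : ℝ) ^ 4 ≤
      (X * X).ncard * ∑ x, ‖conv (X.indicator 1) (X.indicator 1) x‖ ^ 2 := by
  classical
  have h1 : ∑ x, X.indicator (1 : G0 F → ℂ) x = X.ncard := by
    rw [Set.ncard_eq_toFinset_card' X, Finset.card_eq_sum_ones, Nat.cast_sum,
      ← Finset.sum_subset (Finset.subset_univ X.toFinset)]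
    · exact Finset.sum_congr rfl fun x hx => by simp [Set.mem_toFinset.1 hx]
    · intro x _ hx
      rw [Set.indicator_of_notMem (fun h => hx (Set.mem_toFinset.2 h))]
  have h2 := sum_conv (X.indicator (1 : G0 F → ℂ)) (X.indicator 1)
  rw [h1, ← Finset.sum_subset (Finset.subset_univ (X * X).toFinset)] at h2
  · calc (X.ncard : ℝ) ^ 4
        = ‖∑ x ∈ (X * X).toFinset, conv (X.indicator (1 : G0 F → ℂ)) (X.indicator 1) x‖ ^ 2 := by
          rw [h2, norm_mul, Complex.norm_natCast]
          ring
      _ ≤ (∑ x ∈ (X * X).toFinset, ‖conv (X.indicator (1 : G0 F → ℂ)) (X.indicator 1) x‖) ^ 2 :=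
          pow_le_pow_left₀ (norm_nonneg _) (norm_sum_le _ _) 2
      _ ≤ (X * X).toFinset.card *
            ∑ x ∈ (X * X).toFinset, ‖conv (X.indicator (1 : G0 F → ℂ)) (X.indicator 1) x‖ ^ 2 :=
          sq_sum_le_card_mul_sum_sq
      _ ≤ _ := by
          rw [Set.ncard_eq_toFinset_card' (X * X)]
          refine mul_le_mul_of_nonneg_left ?_ (by positivity)
          exact Finset.sum_le_sum_of_subset_of_nonneg (Finset.subset_univ _)
            fun _ _ _ => by positivity
  · intro x _ hx
    refine Finset.sum_eq_zero fun y _ => ?_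
    by_contra hne
    have hy := Set.mem_of_indicator_ne_zero (left_ne_zero_of_mul hne)
    have hz := Set.mem_of_indicator_ne_zero (right_ne_zero_of_mul hne)
    exact hx (Set.mem_toFinset.2 ⟨y, hy, y⁻¹ * x, hz, mul_inv_cancel_left y x⟩)

theorem card_mul_ncard_pow_four_le (h2 : (2 : F) ≠ 0) {X : Set (G0 F)} {M : ℝ} {k : ℕ}
    (hX : SmallBiasOutside X M k) :
    (Fintype.card F : ℝ) ^ 2 * Fintype.card (SO2 F) * (X.ncard : ℝ) ^ 4 ≤
      (X * X).ncard * (k * (X.ncard : ℝ) ^ 4 +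
        Fintype.card (SO2 F) * ((Fintype.card F : ℝ) ^ 2 * Fintype.card (SO2 F) * M) ^ 4 +
        (Fintype.card F : ℝ) ^ 4 * Fintype.card (SO2 F) * (X.ncard : ℝ) ^ 2) := by
  have a1 := ncard_pow_four_le_mul_sum X
  have a2 := sum_norm_sq_conv_le h2 (X.indicator (1 : G0 F → ℂ)) (X.indicator 1)
  have a3 := sum_norm_pow_four_le hX
  rw [sum_norm_pow_four, card_G0, Nat.cast_mul, Nat.cast_pow] at a3
  rw [sum_norm_indicator X 2 two_ne_zero] at a2
  set E := ∑ x, ‖conv (X.indicator (1 : G0 F → ℂ)) (X.indicator 1) x‖ ^ 2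
  set q : ℝ := (Fintype.card F : ℝ)
  set H : ℝ := (Fintype.card (SO2 F) : ℝ)
  have hH : 0 ≤ H := Nat.cast_nonneg _
  calc q ^ 2 * H * (X.ncard : ℝ) ^ 4 ≤ q ^ 2 * H * ((X * X).ncard * E) :=
        mul_le_mul_of_nonneg_left a1 (by positivity)
    _ = (X * X).ncard * (H * (q ^ 2 * E)) := by ring
    _ ≤ _ := by
        refine mul_le_mul_of_nonneg_left ?_ (by positivity)
        refine (mul_le_mul_of_nonneg_left a2 hH).trans ?_
        rw [mul_add]
        refine add_le_add a3 (le_of_eq ?_)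
        ring

end TypeI

/-- Were the bound to fail, the three terms of `h` would be at most `3/48`, `16/48` and `1/48` of
the left side. The `3` comes from `q ≤ 3 H`, and the `16` from `H⁴ ≤ (2 q)⁴`. -/
theorem min_bound_of_energy_bound {q H n m M k : ℝ} (hq : 0 < q) (hn : 0 ≤ n) (hm : 0 ≤ m)
    (hk : 0 < k) (hqH : q ≤ 3 * H) (hHq : H ≤ 2 * q)
    (h : q ^ 2 * H * n ^ 4 ≤
      m * (k * n ^ 4 + H * (q ^ 2 * H * M) ^ 4 + q ^ 4 * H * n ^ 2))
    (hM : 48 * m * (q ^ 10 * M ^ 4) ≤ n ^ 4) :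
    1 / 48 * min (q ^ 3 / k) (n ^ 2 / q ^ 2) ≤ m := by
  by_contra! hlt
  have hH : 0 < H := by linarith
  have l1 : 48 * m < q ^ 3 / k := by
    have := min_le_left (q ^ 3 / k) (n ^ 2 / q ^ 2)
    linarith
  have l2 : 48 * m < n ^ 2 / q ^ 2 := by
    have := min_le_right (q ^ 3 / k) (n ^ 2 / q ^ 2)
    linarith
  rw [lt_div_iff₀ (by positivity)] at l1 l2
  have hn0 : 0 < n := by
    refine lt_of_le_of_ne hn fun e => ?_
    rw [← e] at l2
    have : 0 ≤ 48 * m * q ^ 2 := by positivity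
    linarith
  have b1 : 48 * (m * k * n ^ 4) ≤ 3 * (q ^ 2 * H * n ^ 4) := by
    have : 48 * m * k ≤ 3 * (q ^ 2 * H) := by nlinarith [sq_nonneg q]
    nlinarith [pow_pos hn0 4]
  have b2 : 48 * (m * (H * (q ^ 2 * H * M) ^ 4)) ≤ 16 * (q ^ 2 * H * n ^ 4) := by
    have e1 : H ^ 4 ≤ 16 * q ^ 4 := by
      calc H ^ 4 ≤ (2 * q) ^ 4 := pow_le_pow_left₀ hH.le hHq 4
        _ = 16 * q ^ 4 := by ring
    calc 48 * (m * (H * (q ^ 2 * H * M) ^ 4)) = (48 * m * q ^ 8 * M ^ 4 * H) * H ^ 4 := by ring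
      _ ≤ (48 * m * q ^ 8 * M ^ 4 * H) * (16 * q ^ 4) :=
          mul_le_mul_of_nonneg_left e1 (by positivity)
      _ = 16 * (q ^ 2 * H) * (48 * m * (q ^ 10 * M ^ 4)) := by ring
      _ ≤ 16 * (q ^ 2 * H) * n ^ 4 := mul_le_mul_of_nonneg_left hM (by positivity)
      _ = _ := by ring
  have b3 : 48 * (m * (q ^ 4 * H * n ^ 2)) ≤ q ^ 2 * H * n ^ 4 := by
    calc 48 * (m * (q ^ 4 * H * n ^ 2)) = (q ^ 2 * H * n ^ 2) * (48 * m * q ^ 2) := by ring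
      _ ≤ (q ^ 2 * H * n ^ 2) * n ^ 2 := mul_le_mul_of_nonneg_left l2.le (by positivity)
      _ = _ := by ring
  have : 0 < q ^ 2 * H * n ^ 4 := by positivity
  -- The contradiction is `48 ≤ 3 + 16 + 1`.
  nlinarith

/-! ### The lower bound for product sets. -/

section LowerBound

variable {F : Type*} [Field F] [Fintype F]

theorem card_le_three_mul_card_SO2 (hF : Odd (Fintype.card F)) :
    Fintype.card F ≤ 3 * Fintype.card (SO2 F) := by
  have h1 := SO2.le_card (two_ne_zero_of_odd_card hF)
  have h2 : 1 < Fintype.card F := Fintype.one_lt_card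
  obtain ⟨r, hr⟩ := hF
  omega

theorem SmallBiasOutside.bound_of_le (hF : Odd (Fintype.card F)) {X : Set (G0 F)} {M : ℝ} {k : ℕ}
    (hk : 0 < k) (h : SmallBiasOutside X M k)
    (hM' : 48 * ((X * X).ncard : ℝ) * ((Fintype.card F : ℝ) ^ 10 * M ^ 4) ≤ (X.ncard : ℝ) ^ 4) :
    1 / 48 * min ((Fintype.card F : ℝ) ^ 3 / k) ((X.ncard : ℝ) ^ 2 / (Fintype.card F : ℝ) ^ 2) ≤
      ((X * X).ncard : ℝ) := by
  have hqH : (Fintype.card F : ℝ) ≤ 3 * (Fintype.card (SO2 F) : ℝ) := by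
    exact_mod_cast card_le_three_mul_card_SO2 hF
  have hHq : (Fintype.card (SO2 F) : ℝ) ≤ 2 * (Fintype.card F : ℝ) := by
    exact_mod_cast SO2.card_le
  exact min_bound_of_energy_bound (Nat.cast_pos.2 Fintype.card_pos) (Nat.cast_nonneg _)
    (Nat.cast_nonneg _) (Nat.cast_pos.2 hk) hqH hHq
    (card_mul_ncard_pow_four_le (two_ne_zero_of_odd_card hF) h) hM'

theorem SmallBiasOutside.bound_zero (hF : Odd (Fintype.card F)) {X : Set (G0 F)} {k : ℕ}
    (hk : 0 < k) (h : SmallBiasOutside X 0 k) :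
    1 / 48 * min ((Fintype.card F : ℝ) ^ 3 / k) ((X.ncard : ℝ) ^ 2 / (Fintype.card F : ℝ) ^ 2) ≤
      ((X * X).ncard : ℝ) :=
  h.bound_of_le hF hk (by
    rw [zero_pow four_ne_zero, mul_zero, mul_zero]
    positivity)

theorem SmallBiasOutside.bound (hF : Odd (Fintype.card F)) {X : Set (G0 F)} {M : ℝ} {k : ℕ}
    (hk : 0 < k) (h : SmallBiasOutside X M k) (hM : M ≠ 0) :
    1 / 48 * min ((Fintype.card F : ℝ) ^ 3 / k)
        (min ((X.ncard : ℝ) ^ 4 / ((Fintype.card F : ℝ) ^ 10 * M ^ 4))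
          ((X.ncard : ℝ) ^ 2 / (Fintype.card F : ℝ) ^ 2)) ≤
      ((X * X).ncard : ℝ) := by
  have hq : (0 : ℝ) < Fintype.card F := Nat.cast_pos.2 Fintype.card_pos
  have hle := min_le_min_left ((Fintype.card F : ℝ) ^ 3 / k)
    (min_le_right ((X.ncard : ℝ) ^ 4 / ((Fintype.card F : ℝ) ^ 10 * M ^ 4))
      ((X.ncard : ℝ) ^ 2 / (Fintype.card F : ℝ) ^ 2))
  -- Either the `M` term is harmless and the two-term bound applies, or the middle entry of the
  -- minimum is already at most `48 |XX|`.
  by_cases hM' : 48 * ((X * X).ncard : ℝ) * ((Fintype.card F : ℝ) ^ 10 * M ^ 4) ≤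
    (X.ncard : ℝ) ^ 4
  · exact (mul_le_mul_of_nonneg_left hle (by norm_num)).trans (h.bound_of_le hF hk hM')
  · push Not at hM'
    have h1 := (min_le_right ((Fintype.card F : ℝ) ^ 3 / k) _).trans
      (min_le_left ((X.ncard : ℝ) ^ 4 / ((Fintype.card F : ℝ) ^ 10 * M ^ 4))
        ((X.ncard : ℝ) ^ 2 / (Fintype.card F : ℝ) ^ 2))
    have h2 : (X.ncard : ℝ) ^ 4 / ((Fintype.card F : ℝ) ^ 10 * M ^ 4) ≤
        48 * ((X * X).ncard : ℝ) := by
      rw [div_le_iff₀ (by positivity)]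
      exact hM'.le
    linarith

end LowerBound

/-! ### Sharpness for preimages of subgroups of rotations. -/

section Sharpness

variable {F : Type*} [Field F]

/-- A representation whose lift is irreducible is irreducible. -/
theorem isIrreducible_of_lift {G H V : Type*} [Group G] [Group H] [AddCommGroup V] [Module ℂ V]
    {ρ : Representation ℂ G V} {σ : Representation ℂ H V} {f : G → H}
    (h : ∀ g, ρ g = σ (f g)) (hρ : ρ.IsIrreducible) : σ.IsIrreducible := by
  have : Nontrivial (Subrepresentation σ) := by
    refine ⟨⊥, ⊤, fun e => bot_ne_top (α := Subrepresentation ρ) ?_⟩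
    have e' : (⊥ : Submodule ℂ V) = ⊤ := congrArg (Subrepresentation.toSubmodule (ρ := σ)) e
    exact Subrepresentation.toSubmodule_injective e'
  refine ⟨fun a => ?_⟩
  let b : Subrepresentation ρ := ⟨a.toSubmodule, fun g v hv => by
    rw [h]
    exact a.apply_mem_toSubmodule _ hv⟩
  rcases hρ.eq_bot_or_eq_top b with hb | hb
  · have ha : a.toSubmodule = ⊥ := congrArg (Subrepresentation.toSubmodule (ρ := ρ)) hb
    exact Or.inl (Subrepresentation.toSubmodule_injective ha)
  · have ha : a.toSubmodule = ⊤ := congrArg (Subrepresentation.toSubmodule (ρ := ρ)) hb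
    exact Or.inr (Subrepresentation.toSubmodule_injective ha)

/-- Every type I irreducible representation is given by a character of the rotation group. -/
theorem TypeIIrrep.exists_character (ρ : TypeIIrrep F) : ρ.degree = 1 ∧
    ∃ χ : AddChar (Additive (SO2 F)) ℂ,
      ∀ g, ρ.rep g = χ (Additive.ofMul g.right) • LinearMap.id := by
  obtain ⟨σ, hσ⟩ := ρ.lifted
  have hirr : σ.IsIrreducible := isIrreducible_of_lift hσ ρ.irreducible
  -- Rotations commute, so an irreducible representation of them has degree one.
  have h1 : Module.finrank ℂ (EuclideanSpace ℂ (Fin ρ.degree)) = 1 :=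
    Representation.IsIrreducible.finrank_eq_one_of_isMulCommutative σ
  refine ⟨by simpa using h1, ?_⟩
  obtain ⟨v, hv⟩ : ∃ v : EuclideanSpace ℂ (Fin ρ.degree), v ≠ 0 :=
    have := Module.nontrivial_of_finrank_pos (R := ℂ) (h1 ▸ one_pos)
    exists_ne 0
  choose c hc _ using fun h => LinearMap.existsUnique_eq_smul_id_of_finrank_eq_one h1 (σ h)
  have inj := smul_left_injective ℂ (m := v) hv
  have c_one : c 1 = 1 := by
    have := LinearMap.congr_fun (hc 1) v
    rw [map_one] at this
    exact inj (this.symm.trans (one_smul ℂ v).symm)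
  have c_mul : ∀ g h, c (g * h) = c g * c h := fun g h => by
    have := LinearMap.congr_fun (hc (g * h)) v
    rw [map_mul, hc g, hc h] at this
    exact inj (this.symm.trans (mul_smul (c g) (c h) v).symm)
  exact ⟨⟨fun a => c a.toMul, c_one, fun a b => c_mul a.toMul b.toMul⟩,
    fun g => (hσ g).trans (hc g.right)⟩

theorem TypeIIrrep.nonempty_equiv_charRep (ρ : TypeIIrrep F) (hd : ρ.degree = 1)
    {χ : AddChar (Additive (SO2 F)) ℂ}
    (h : ∀ g, ρ.rep g = χ (Additive.ofMul g.right) • LinearMap.id) :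
    Nonempty (ρ.rep.Equiv (charRep χ)) := by
  let e : EuclideanSpace ℂ (Fin ρ.degree) ≃ₗ[ℂ] EuclideanSpace ℂ (Fin 1) :=
    LinearEquiv.ofFinrankEq _ _ (by simp [hd])
  refine ⟨Representation.Equiv.mk e fun g => ?_⟩
  rw [h, charRep_apply, LinearMap.comp_smul, LinearMap.smul_comp, LinearMap.comp_id,
    LinearMap.id_comp]

/-- A finite cyclic group has, for each factorisation `k * l` of its order, a subgroup of order `l`
with at most `k` characters trivial on it. -/
theorem exists_subgroup_card_characters_le {H : Type*} [CommGroup H] [Fintype H] [IsCyclic H]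
    {k l : ℕ} (hkl : k * l = Fintype.card H) : ∃ L : Subgroup H, Nat.card L = l ∧
      ∃ B : Finset (AddChar (Additive H) ℂ), B.card ≤ k ∧
        ∀ χ : AddChar (Additive H) ℂ, (∀ h ∈ L, χ (Additive.ofMul h) = 1) → χ ∈ B := by
  classical
  obtain ⟨g, hg⟩ := IsCyclic.exists_generator (α := H)
  have hpos : 0 < k * l := hkl ▸ Fintype.card_pos
  have hk : 0 < k := Nat.pos_of_mul_pos_right hpos
  have hord : orderOf g = k * l := by
    rw [orderOf_eq_card_of_forall_mem_zpowers hg, Nat.card_eq_fintype_card, hkl]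
  have : Finite (Additive H) := inferInstanceAs (Finite H)
  -- A character is determined by its value at the generator `g`, and triviality on `g ^ k` makes
  -- that value a `k`-th root of unity.
  refine ⟨Subgroup.zpowers (g ^ k), ?_, Finset.univ.filter fun χ => χ (Additive.ofMul g) ^ k = 1,
    ?_, fun χ hχ => Finset.mem_filter.2 ⟨Finset.mem_univ _, ?_⟩⟩
  · rw [Nat.card_zpowers, orderOf_pow_of_dvd hk.ne' (hord ▸ Dvd.intro _ rfl), hord,
      Nat.mul_div_cancel_left _ hk]
  · calc (Finset.univ.filter fun χ : AddChar (Additive H) ℂ => χ (Additive.ofMul g) ^ k = 1).card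
        ≤ (Polynomial.nthRootsFinset k (1 : ℂ)).card := by
          refine Finset.card_le_card_of_injOn (fun χ => χ (Additive.ofMul g)) (fun χ hχ => ?_) ?_
          · exact (Polynomial.mem_nthRootsFinset hk 1).2 (Finset.mem_filter.1 hχ).2
          · intro χ _ χ' _ h
            refine DFunLike.ext _ _ fun a => ?_
            obtain ⟨n, hn⟩ := Subgroup.mem_zpowers_iff.1 (hg a.toMul)
            have ha : a = n • Additive.ofMul g := hn.symm
            rw [ha, AddChar.map_zsmul_eq_zpow, AddChar.map_zsmul_eq_zpow]
            exact congrArg (· ^ n) h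
      _ ≤ k := (Multiset.toFinset_card_le _).trans (Polynomial.card_nthRoots k 1)
  · rw [← AddChar.map_nsmul_eq_pow]
    exact hχ _ (Subgroup.mem_zpowers _)

variable [Fintype F]

/-- Orthogonality: left translation by `h₀` preserves the preimage of `L` but multiplies the
character sum by `χ h₀ ≠ 1`. -/
theorem fourierCoeff_comap_eq_zero (L : Subgroup (SO2 F)) {V : Type*} [AddCommGroup V] [Module ℂ V]
    {ρ : Representation ℂ (G0 F) V} {χ : AddChar (Additive (SO2 F)) ℂ}
    (hρ : ∀ g, ρ g = χ (Additive.ofMul g.right) • LinearMap.id)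
    {h₀ : SO2 F} (hL : h₀ ∈ L) (hχ : χ (Additive.ofMul h₀) ≠ 1) :
    fourierCoeff
      (((L.comap SemidirectProduct.rightHom : Subgroup (G0 F)) : Set (G0 F)).indicator 1) ρ = 0 := by
  classical
  set X : Set (G0 F) := ↑(L.comap SemidirectProduct.rightHom : Subgroup (G0 F))
  have hmem : ∀ g : G0 F, g ∈ X ↔ g.right ∈ L := fun g => Iff.rfl
  have hsum : ∑ g, X.indicator (1 : G0 F → ℂ) g * χ (Additive.ofMul g.right) = 0 := by
    set s := ∑ g, X.indicator (1 : G0 F → ℂ) g * χ (Additive.ofMul g.right) with hs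
    have : s = χ (Additive.ofMul h₀) * s := by
      conv_rhs => rw [hs, Finset.mul_sum]
      symm
      refine Fintype.sum_equiv (Equiv.mulLeft (SemidirectProduct.inr h₀)) _ _ fun g => ?_
      have e : (SemidirectProduct.inr h₀ * g : G0 F).right = h₀ * g.right := by
        rw [SemidirectProduct.mul_right, SemidirectProduct.right_inr]
      rw [Equiv.coe_mulLeft, Set.indicator_apply, Set.indicator_apply, hmem, hmem, e,
        Subgroup.mul_mem_cancel_left _ hL, ofMul_mul, AddChar.map_add_eq_mul,
        Pi.one_apply, Pi.one_apply]
      ring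
    have h0 : (χ (Additive.ofMul h₀) - 1) * s = 0 := by linear_combination -this
    exact (mul_eq_zero.1 h0).resolve_left (sub_ne_zero.2 hχ)
  rw [fourierCoeff]
  simp_rw [hρ, smul_smul]
  rw [← Finset.sum_smul, hsum, zero_smul, smul_zero]

theorem ncard_comap_rightHom (L : Subgroup (SO2 F)) :
    ((L.comap SemidirectProduct.rightHom : Subgroup (G0 F)) : Set (G0 F)).ncard =
      Nat.card L * Fintype.card F ^ 2 := by
  have h1 := Subgroup.index_comap_of_surjective (H := L)
    (f := (SemidirectProduct.rightHom : G0 F →* SO2 F)) SemidirectProduct.rightHom_surjective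
  have h2 := L.card_mul_index
  have h3 := (L.comap (SemidirectProduct.rightHom : G0 F →* SO2 F)).card_mul_index
  rw [h1, Nat.card_eq_fintype_card (α := G0 F), card_G0, ← Nat.card_eq_fintype_card (α := SO2 F),
    ← h2] at h3
  have h4 : L.index ≠ 0 := Subgroup.index_ne_zero_of_finite
  change Nat.card (L.comap (SemidirectProduct.rightHom : G0 F →* SO2 F)) = _
  refine Nat.eq_of_mul_eq_mul_right (Nat.pos_of_ne_zero h4) (h3.trans ?_)
  ring

theorem exists_sharp_subgroup (hF : Odd (Fintype.card F)) {k l : ℕ}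
    (hkl : k * l = Fintype.card (SO2 F)) : ∃ X : Subgroup (G0 F),
      (X : Set (G0 F)).ncard = l * Fintype.card F ^ 2 ∧
      SmallBiasOutside (X : Set (G0 F)) 0 k ∧
      (((X : Set (G0 F)) * (X : Set (G0 F))).ncard : ℝ) ≤
        2 * min ((Fintype.card F : ℝ) ^ 3 / k)
          (((X : Set (G0 F)).ncard : ℝ) ^ 2 / (Fintype.card F : ℝ) ^ 2) := by
  classical
  have := SO2.isCyclic (two_ne_zero_of_odd_card hF)
  obtain ⟨L, hL, B, hB, hBL⟩ := exists_subgroup_card_characters_le hkl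
  have hcard := ncard_comap_rightHom L
  rw [hL] at hcard
  refine ⟨L.comap SemidirectProduct.rightHom, hcard, ⟨B.image charIrrep,
    Finset.card_image_le.trans hB, fun ρ hρ => ?_⟩, ?_⟩
  · obtain ⟨hd, χ, hχ⟩ := ρ.exists_character
    have hne : ∃ h₀ ∈ L, χ (Additive.ofMul h₀) ≠ 1 := by
      by_contra! h
      exact hρ _ (Finset.mem_image_of_mem _ (hBL χ h)) (ρ.nonempty_equiv_charRep hd hχ)
    obtain ⟨h₀, h₀L, h₀χ⟩ := hne
    rw [fourierCoeff_comap_eq_zero L hχ h₀L h₀χ, hsNorm, LinearMap.comp_zero, map_zero,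
      Complex.zero_re, Real.sqrt_zero]
  -- A subgroup is its own product set, so `l q²` is compared with both entries: `k l ≤ 2 q` handles
  -- the first and forces the constant `2`; `l ≥ 1` handles the second.
  · rw [coe_mul_coe, hcard]
    have hpos : 0 < k * l := hkl ▸ Fintype.card_pos
    have hk : (0 : ℝ) < k := Nat.cast_pos.2 (Nat.pos_of_mul_pos_right hpos)
    have hl : (1 : ℝ) ≤ l := Nat.one_le_cast.2 (Nat.pos_of_mul_pos_left hpos)
    have hq : (0 : ℝ) < Fintype.card F := Nat.cast_pos.2 Fintype.card_pos
    have hH : (k : ℝ) * l ≤ 2 * Fintype.card F := by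
      exact_mod_cast hkl.trans_le SO2.card_le
    push_cast
    rw [mul_min_of_nonneg _ _ (by norm_num : (0 : ℝ) ≤ 2)]
    refine le_min ?_ ?_
    · rw [mul_div_assoc', le_div_iff₀ hk]
      nlinarith [mul_le_mul_of_nonneg_right hH (sq_nonneg (Fintype.card F : ℝ))]
    · have e : ((l : ℝ) * (Fintype.card F : ℝ) ^ 2) ^ 2 / (Fintype.card F : ℝ) ^ 2 =
          l ^ 2 * (Fintype.card F : ℝ) ^ 2 := by
        field_simp
      rw [e]
      nlinarith [mul_le_mul_of_nonneg_right hl (sq_nonneg (Fintype.card F : ℝ)),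
        sq_nonneg (Fintype.card F : ℝ)]

end Sharpness

end RigidMotion

theorem theorem8 :
    -- the lower bound, with an absolute implied constant
    (∃ c : ℝ, 0 < c ∧
      ∀ (F : Type*) [Field F] [Fintype F], Odd (Fintype.card F) →
      ∀ (X : Set (RigidMotion.G0 F)) (M : ℝ) (k : ℕ), 0 < k →
        RigidMotion.SmallBiasOutside X M k →
        (M ≠ 0 →
          c * min ((Fintype.card F : ℝ) ^ 3 / k)
                (min ((X.ncard : ℝ) ^ 4 / ((Fintype.card F : ℝ) ^ 10 * M ^ 4))
                     ((X.ncard : ℝ) ^ 2 / (Fintype.card F : ℝ) ^ 2))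
            ≤ ((X * X).ncard : ℝ)) ∧
        (M = 0 →
          c * min ((Fintype.card F : ℝ) ^ 3 / k)
                ((X.ncard : ℝ) ^ 2 / (Fintype.card F : ℝ) ^ 2)
            ≤ ((X * X).ncard : ℝ))) ∧
    -- sharpness: for every factorisation `|SO₂(F)| = k l` there is a subgroup of order `l q²` that
    -- satisfies the hypothesis with `M = 0` and attains the bound up to an absolute constant
    (∃ C : ℝ, 0 < C ∧
      ∀ (F : Type*) [Field F] [Fintype F], Odd (Fintype.card F) →
      ∀ k l : ℕ, k * l = Fintype.card (RigidMotion.SO2 F) →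
        ∃ X : Subgroup (RigidMotion.G0 F),
          (X : Set (RigidMotion.G0 F)).ncard = l * Fintype.card F ^ 2 ∧
          RigidMotion.SmallBiasOutside (X : Set (RigidMotion.G0 F)) 0 k ∧
          (((X : Set (RigidMotion.G0 F)) * (X : Set (RigidMotion.G0 F))).ncard : ℝ) ≤
            C * min ((Fintype.card F : ℝ) ^ 3 / k)
                  (((X : Set (RigidMotion.G0 F)).ncard : ℝ) ^ 2 / (Fintype.card F : ℝ) ^ 2)) := by
  refine ⟨⟨1 / 48, by norm_num, ?_⟩, ⟨2, two_pos, ?_⟩⟩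
  · intro F _ _ hF X M k hk h
    exact ⟨fun hM => h.bound hF hk hM, fun hM => (hM ▸ h).bound_zero hF hk⟩
  · intro F _ _ hF k l hkl
    exact RigidMotion.exists_sharp_subgroup hF hkl
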